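/- Let $(\mathcal X,\rho)$ be a separable metric space and let $(X,Y)\in\mathcal X\times\{0,1\}$ have joint distribution $P$, with marginal $\mu$ of $X$ and regression function $\eta(x)=\mathbb P(Y=1\mid X=x)\in[0,1]$. The risk of $g:\mathcal X\to\{0,1\}$ is $\mathbb P(g(X)\ne Y)$; its regret is its risk minus the risk of the Bayes classifier $\mathbb 1\{\eta(x)>1/2\}$. Let the training data $\mathcal D$ consist of $N=sn$ independent copies of $(X,Y)$, divided into $s$ subsamples of size $n$. For $1\le k\le n$, let $g^{(j)}_{n,k}(x)=1$ iff the average label of the $k$ nearest neighbors of $x$ in the $j$th subsample exceeds $1/2$ (distance ties broken by index), and let $g^*_{n,k,s}(x)=\mathbb 1\{\frac1s\sum_{j=1}^s g^{(j)}_{n,k}(x)>1/2\}$ (the bigNN classifier). Let $\mathcal D_{sub}$ consist of $m\ge1$ of the $N$ observations, with indices fixed independently of the data, let $\mathrm{NN}(x;\mathcal D_{sub})$ be the nearest neighbor of $x$ in $\mathcal D_{sub}$ and let $g^\sharp(x)=g^*_{n,k,s}(\mathrm{NN}(x;\mathcal D_{sub}))$ (the denoised bigNN classifier). Assume that 1.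 the class of closed balls $B(x,r)$, $r>0$, of $\mathcal X$ has finite VC dimension $d_{vc}$; 2. $\mu$ has intrinsic dimension $d'$ (a positive integer) with constant $C_d>0$: $\mu(B(x,r))\ge\min(1,C_d r^{d'})$ for all $x\in\mathcal X$, $r>0$; 3. $\eta$ is $\alpha_H$-Hölder, $\alpha_H>0$: $|\eta(x)-\eta(x')|\le L\rho(x,x')^{\alpha_H}$ for all $x,x'$; 4. the $\beta$-margin condition holds, $\beta\ge0$: $\mathbb P(|\eta(X)-1/2|\le t)\le C_0t^\beta$ for all $t>0$. Then there are constants $C,A>0$, depending only on $\alpha_H,L,\beta,C_0,d'$, such that the following holds. Let $0<\delta<1$ and put $\psi=\left(\frac{d_{vc}\log(m/\delta)}{mC_d}\right)^{\alpha_H/d'}$. Suppose that $n$, $k$ and $s$ are large enough for the given $m$ and $\delta$, in the sense that $$A\,k\,m\le n\,d_{vc}\log(m/\delta),\qquad A\le k\psi^2,\qquad A\log(m/\delta)\le s\,k\,\psi^2$$ (for fixed $m,\delta$ and $d_{vc}\ge1$ this is true as soon as $k$ and $n/k$ are large enough, whatever $s\ge1$ is). Then, with probability at least $1-3\delta$ over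 $\mathcal D$, $$\text{Regret of }g^\sharp\le\text{Regret of }g^*_{n,k,s}+C\left(\frac{d_{vc}\log(m/\delta)}{mC_d}\right)^{\alpha_H(\beta+1)/d'}.$$ -/

import Mathlib

open MeasureTheory Set
open scoped NNReal

noncomputable section

/-- `η` is (a version, with values in `[0, 1]`, of) the class conditional probability
`η(x) = ℙ(Y = 1 | X = x)` of the joint distribution `P` of `(X, Y)`. The label `1` is `true`,
and the marginal distribution `μ` of `X` is `P.fst`. -/
structure IsRegressionFunction {X : Type*} [MeasurableSpace X] (P : Measure (X × Bool))
    (η : X → ℝ) : Prop where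
  measurable : Measurable η
  nonneg : ∀ x, 0 ≤ η x
  le_one : ∀ x, η x ≤ 1
  setIntegral_eq : ∀ A : Set X, MeasurableSet A → P.real (A ×ˢ {true}) = ∫ x in A, η x ∂P.fst

/-- The risk `ℙ(g(X) ≠ Y)` of a classifier `g`. -/
def risk {X : Type*} [MeasurableSpace X] (P : Measure (X × Bool)) (g : X → Bool) : ℝ :=
  P.real {z | g z.1 ≠ z.2}

/-- The Bayes classifier `1{η(x) > 1/2}`. -/
def bayesClassifier {X : Type*} (η : X → ℝ) (x : X) : Bool := decide (1 / 2 < η x)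

/-- The regret (excess risk) of a classifier `g`. -/
def regret {X : Type*} [MeasurableSpace X] (P : Measure (X × Bool)) (η : X → ℝ)
    (g : X → Bool) : ℝ :=
  risk P g - risk P (bayesClassifier η)

/-- The margin condition with exponent `β` and constant `C₀`. -/
def MarginCondition {X : Type*} [MeasurableSpace X] (P : Measure (X × Bool)) (η : X → ℝ)
    (β C₀ : ℝ) : Prop :=
  ∀ t : ℝ, 0 < t → P.fst.real {x | |η x - 1 / 2| ≤ t} ≤ C₀ * t ^ β

/-- Intrinsic dimension `d'` with constant `Cd`: `μ(B(x, r)) ≥ Cd * r ^ d'`, where the lower bound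
is capped at the total mass `1` of `μ`. -/
def HasIntrinsicDim {X : Type*} [MetricSpace X] [MeasurableSpace X] (μ : Measure X)
    (d' : ℕ) (Cd : ℝ) : Prop :=
  ∀ (x : X) (r : ℝ), 0 < r → min 1 (Cd * r ^ d') ≤ μ.real (Metric.closedBall x r)

/-- The family `𝒞` of sets picks out every subset of the finite set `F`. -/
def IsShatteredBy {X : Type*} (𝒞 : Set (Set X)) (F : Finset X) : Prop :=
  ∀ G : Finset X, G ⊆ F → ∃ B ∈ 𝒞, ∀ x ∈ F, (x ∈ B ↔ x ∈ G)

/-- The Vapnik-Chervonenkis dimension of a family of sets. -/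
def vcDimension {X : Type*} (𝒞 : Set (Set X)) : ℕ∞ :=
  ⨆ (F : Finset X) (_ : IsShatteredBy 𝒞 F), (F.card : ℕ∞)

/-- The class of all closed balls of a metric space. -/
def closedBalls (X : Type*) [MetricSpace X] : Set (Set X) :=
  {B | ∃ (x : X) (r : ℝ), 0 < r ∧ B = Metric.closedBall x r}

/-- The number of points of the sample `D` that come before the `i`-th point when the sample is
ordered by the distance to `x`, ties being broken in favour of the smaller index. -/
def nnRank {X : Type*} [MetricSpace X] {n : ℕ} (D : Fin n → X × Bool) (x : X) (i : Fin n) : ℕ :=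
  (Finset.univ.filter fun l : Fin n =>
    dist x (D l).1 < dist x (D i).1 ∨ (dist x (D l).1 = dist x (D i).1 ∧ l < i)).card

/-- The (indices of the) `k` nearest neighbors of `x` in the sample `D`. -/
def kNearest {X : Type*} [MetricSpace X] {n : ℕ} (D : Fin n → X × Bool) (k : ℕ) (x : X) :
    Finset (Fin n) :=
  Finset.univ.filter fun i => nnRank D x i < k

/-- The average of the labels of the `k` nearest neighbors of `x` in the sample `D`. -/
def labelAverage {X : Type*} [MetricSpace X] {n : ℕ} (D : Fin n → X × Bool) (k : ℕ) (x : X) : ℝ :=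
  (∑ i ∈ kNearest D k x, if (D i).2 = true then (1 : ℝ) else 0) / k

/-- The `k`-nearest neighbor classifier of the sample `D`. -/
def knnClassifier {X : Type*} [MetricSpace X] {n : ℕ} (D : Fin n → X × Bool) (k : ℕ) (x : X) :
    Bool :=
  decide (1 / 2 < labelAverage D k x)

/-- The bigNN classifier: the majority vote of the `k`-nearest neighbor classifiers of the `s`
subsamples of size `n`; the `i`-th observation of the `j`-th subsample is `D (j, i)`. -/
def bigNN {X : Type*} [MetricSpace X] {s n : ℕ} (D : Fin s × Fin n → X × Bool) (k : ℕ) (x : X) :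
    Bool :=
  decide (1 / 2 <
    (∑ j : Fin s, if knnClassifier (fun i => D (j, i)) k x = true then (1 : ℝ) else 0) / s)

theorem exists_nnRank_eq_zero {X : Type*} [MetricSpace X] {m : ℕ} [NeZero m]
    (D : Fin m → X × Bool) (x : X) : ∃ i, nnRank D x i = 0 := by
  obtain ⟨i, -, hi⟩ := Finset.exists_min_image Finset.univ
    (fun i : Fin m => toLex (dist x (D i).1, i)) ⟨0, Finset.mem_univ _⟩
  refine ⟨i, ?_⟩
  rw [nnRank, Finset.card_eq_zero, Finset.filter_eq_empty_iff]
  intro l _ hl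
  have h := hi l (Finset.mem_univ l)
  rw [Prod.Lex.toLex_le_toLex] at h
  simp only at h
  rcases hl with hl | ⟨hl, hl'⟩
  · rcases h with h | ⟨h, -⟩ <;> linarith
  · rcases h with h | ⟨-, h⟩
    · linarith
    · exact absurd hl' (not_lt.mpr h)

/-- The nearest neighbor of `x` in the nonempty sample `D`. -/
def nearestNeighbor {X : Type*} [MetricSpace X] {m : ℕ} [NeZero m] (D : Fin m → X × Bool)
    (x : X) : X :=
  (D (exists_nnRank_eq_zero D x).choose).1

/-- The denoised bigNN classifier: the bigNN prediction at the nearest neighbor of `x` among the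
subsample of size `m` of the whole training data that consists of the observations with the
distinct indices `e 0, …, e (m - 1)`. -/
def denoisedBigNN {X : Type*} [MetricSpace X] {s n m : ℕ} [NeZero m]
    (D : Fin s × Fin n → X × Bool) (k : ℕ) (e : Fin m ↪ Fin s × Fin n) (x : X) : Bool :=
  bigNN D k (nearestNeighbor (fun i => D (e i)) x)

end

/-! The regret of bigNN is nonnegative, so it suffices to bound the regret of the denoised
classifier by a multiple of `ψ ^ (β + 1)`. By the margin condition and `regret_le`, this holds once
that classifier agrees with Bayes wherever `|η - 1 / 2| > K * ψ`.

Let `ρ` be the radius with `Cd * ρ ^ d' = V / m`, where `V = dvc * log (m / δ)`; then `ρ ^ α = ψ`. A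
packing argument (`measureReal_exists_far_le`) shows that, outside an event of probability at most
`δ`, every point of the space has one of the `m` subsample points within `4 * ρ`. Passing to the
nearest neighbor then moves `η` by `O(ψ)`, which cannot cross `1 / 2` at the points in question. So
bigNN only has to be right at those of the `m` locations where the margin exceeds `(L + 1) * ψ`. A
failure at one location has probability at most `2 * δ / m` (`measureReal_bigNN_ne_at_sample_le`),
hence `3 * δ` in total.

For one location, a wrong majority means that at least half of the blocks vote wrongly. Except with
small probability, fewer than a quarter of the blocks have fewer than `k` points within `ρ`. Hence
some set `S` of at least `s / 4` blocks has all its neighbors within `ρ`, each label being correct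
with probability at least `1 / 2 + ψ`, and yet at most half of the pooled labels are correct.
Chernoff's bound and a union over the `2 ^ s` choices of `S` give `2 ^ s * exp (-ψ ^ 2 * s * k /
2)`, and `8 ≤ k * ψ ^ 2` absorbs the factor `2 ^ s`. Labels are conditioned on positions by writing
them as thresholded independent uniform variables (`measureReal_pi_le_add`). -/

/-! ### Chernoff bounds for counts of independent coordinates. -/

section TailBounds

variable {ι Ω : Type*} [Fintype ι] [MeasurableSpace Ω]

/-- Chernoff's bound for the lower tail of the number of indices in `J` whose coordinate lies
in `B`. -/
theorem measureReal_pi_count_le (ν : Measure Ω) [IsProbabilityMeasure ν] {B : Set Ω}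
    (hB : MeasurableSet B) (J : Finset ι) {p θ : ℝ} (hp : p ≤ ν.real B) (hθ : 0 < θ)
    (hθ1 : θ ≤ 1) (a : ℝ) :
    (Measure.pi fun _ : ι => ν).real {ω | ∑ i ∈ J, B.indicator (fun _ => (1 : ℝ)) (ω i) ≤ a} ≤
      θ ^ (-a) * (1 - p * (1 - θ)) ^ J.card := by
  classical
  -- An indicator takes only the values 0 and 1, so `θ` to that power is affine in it and its mean
  -- is explicit.
  set h : Ω → ℝ := fun y => 1 - (1 - θ) * B.indicator (fun _ => (1 : ℝ)) y with hh
  have hrpow : ∀ y, θ ^ (B.indicator (fun _ => (1 : ℝ)) y) = h y := by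
    intro y
    by_cases hy : y ∈ B <;> simp [hh, hy]
  have hind : Integrable (B.indicator (fun _ => (1 : ℝ))) ν :=
    (integrable_const 1).indicator hB
  have hhm : Measurable h := (measurable_const.indicator hB).const_mul _ |>.const_sub _
  have hh0 : ∀ y, 0 ≤ h y := fun y => by rw [← hrpow]; positivity
  have hh1 : ∀ y, h y ≤ 1 := fun y => by
    rw [← hrpow]
    exact Real.rpow_le_one hθ.le hθ1 (indicator_nonneg (fun _ _ => zero_le_one) y)
  have hint : ∫ y, h y ∂ν = 1 - (1 - θ) * ν.real B := by
    rw [hh, integral_sub (integrable_const _) (hind.const_mul _), integral_const_mul,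
      integral_indicator_const _ hB]
    simp
  set f : ι → Ω → ℝ := fun i y => if i ∈ J then h y else 1 with hf
  have hprod : ∀ ω : ι → Ω,
      ∏ i, f i (ω i) = θ ^ (∑ i ∈ J, B.indicator (fun _ => (1 : ℝ)) (ω i)) := by
    intro ω
    rw [Real.rpow_sum_of_pos hθ, hf, Finset.prod_ite_mem, Finset.univ_inter]
    exact Finset.prod_congr rfl fun i _ => (hrpow _).symm
  have hfm : Measurable fun ω : ι → Ω => ∏ i, f i (ω i) := by
    refine Finset.measurable_prod _ fun i _ => ?_
    by_cases hi : i ∈ J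
    · simpa [hf, hi, Function.comp_def] using hhm.comp (measurable_pi_apply (X := fun _ : ι => Ω) i)
    · simp [hf, hi]
  have hf0 : ∀ i y, 0 ≤ f i y := fun i y => by
    by_cases hi : i ∈ J <;> simp [hf, hi, hh0]
  have hf1 : ∀ i y, f i y ≤ 1 := fun i y => by
    by_cases hi : i ∈ J <;> simp [hf, hi, hh1]
  have hfi : Integrable (fun ω : ι → Ω => ∏ i, f i (ω i)) (Measure.pi fun _ : ι => ν) := by
    refine Integrable.of_bound hfm.aestronglyMeasurable 1 (ae_of_all _ fun ω => ?_)
    rw [Real.norm_of_nonneg (Finset.prod_nonneg fun i _ => hf0 i _)]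
    exact Finset.prod_le_one (fun i _ => hf0 i _) fun i _ => hf1 i _
  have hmarkov := mul_meas_ge_le_integral_of_nonneg
    (ae_of_all _ fun ω => Finset.prod_nonneg fun i _ => hf0 i (ω i)) hfi (θ ^ a)
  rw [integral_fintype_prod_eq_prod] at hmarkov
  have hpr : ∏ i, ∫ y, f i y ∂ν = (1 - (1 - θ) * ν.real B) ^ J.card := by
    rw [← Finset.prod_const, ← Finset.univ_inter J, ← Finset.prod_ite_mem]
    refine Finset.prod_congr rfl fun i _ => ?_
    by_cases hi : i ∈ J
    · simp [hf, hi, hint]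
    · simp [hf, hi]
  rw [hpr] at hmarkov
  have hsub : {ω : ι → Ω | ∑ i ∈ J, B.indicator (fun _ => (1 : ℝ)) (ω i) ≤ a} ⊆
      {ω | θ ^ a ≤ ∏ i, f i (ω i)} := fun ω hω => by
    simp only [mem_ofPred_eq, hprod]
    exact Real.rpow_le_rpow_of_exponent_ge hθ hθ1 hω
  have hB1 : ν.real B ≤ 1 := measureReal_le_one
  have hbase : (1 - (1 - θ) * ν.real B) ^ J.card ≤ (1 - p * (1 - θ)) ^ J.card := by
    refine pow_le_pow_left₀ ?_ ?_ _
    · nlinarith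
    · nlinarith
  rw [Real.rpow_neg hθ.le, ← div_eq_inv_mul, le_div_iff₀ (by positivity), mul_comm]
  calc _ ≤ θ ^ a * (Measure.pi fun _ : ι => ν).real {ω | θ ^ a ≤ ∏ i, f i (ω i)} := by
        exact mul_le_mul_of_nonneg_left (measureReal_mono hsub) (by positivity)
    _ ≤ _ := hmarkov.trans hbase

/-- If every coordinate lies in `B` with probability at least `1 / 2 + t`, then it is unlikely that
at most half of the indices in `J` have their coordinate in `B`. -/
theorem measureReal_pi_count_le_half (ν : Measure Ω) [IsProbabilityMeasure ν] {B : Set Ω}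
    (hB : MeasurableSet B) (J : Finset ι) {t : ℝ} (ht : 0 ≤ t) (ht' : t < 1 / 2)
    (hp : 1 / 2 + t ≤ ν.real B) :
    (Measure.pi fun _ : ι => ν).real
        {ω | ∑ i ∈ J, B.indicator (fun _ => (1 : ℝ)) (ω i) ≤ J.card / 2} ≤
      Real.exp (-(2 * t ^ 2 * J.card)) := by
  have h1 : 0 < 1 / 2 - t := by linarith
  have h2 : 0 < 1 / 2 + t := by linarith
  -- This `θ` minimizes the Chernoff bound at success probability `1 / 2 + t`; the factor per index
  -- becomes `√(1 - 4 * t ^ 2)`.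
  set θ := (1 / 2 - t) / (1 / 2 + t) with hθd
  have hθ : 0 < θ := div_pos h1 h2
  have hθ1 : θ ≤ 1 := (div_le_one h2).2 (by linarith)
  refine (measureReal_pi_count_le ν hB J hp hθ hθ1 _).trans ?_
  have hb : 1 - (1 / 2 + t) * (1 - θ) = 2 * (1 / 2 - t) := by
    rw [hθd]; field_simp; ring
  have hsq : (θ ^ (-(1 / 2 : ℝ)) * (2 * (1 / 2 - t))) ^ 2 = 1 - 4 * t ^ 2 := by
    rw [mul_pow, ← Real.rpow_natCast, ← Real.rpow_mul hθ.le]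
    norm_num
    rw [Real.rpow_neg_one, hθd]
    field_simp
    ring
  have hle : θ ^ (-(1 / 2 : ℝ)) * (2 * (1 / 2 - t)) ≤ Real.exp (-(2 * t ^ 2)) := by
    refine (abs_le_of_sq_le_sq' ?_ (Real.exp_pos _).le).2
    rw [hsq, ← Real.exp_nat_mul]
    have := Real.add_one_le_exp (-(4 * t ^ 2))
    push_cast
    rw [show 2 * -(2 * t ^ 2) = -(4 * t ^ 2) by ring]
    linarith
  calc θ ^ (-((J.card : ℝ) / 2)) * (1 - (1 / 2 + t) * (1 - θ)) ^ J.card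
      = (θ ^ (-(1 / 2 : ℝ)) * (2 * (1 / 2 - t))) ^ J.card := by
        rw [hb, mul_pow (θ ^ _), ← Real.rpow_natCast (θ ^ _), ← Real.rpow_mul hθ.le]
        congr 2
        ring
    _ ≤ Real.exp (-(2 * t ^ 2)) ^ J.card := by
        refine pow_le_pow_left₀ ?_ hle _
        positivity
    _ = _ := by
        rw [← Real.exp_nat_mul]
        congr 1
        ring

/-- It is unlikely that fewer than `K` of the indices in `J` have their coordinate in `B`, if the
expected number of those is at least `4 * K`. -/
theorem measureReal_pi_count_lt (ν : Measure Ω) [IsProbabilityMeasure ν] {B : Set Ω}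
    (hB : MeasurableSet B) (J : Finset ι) {p K : ℝ} (hp0 : 0 ≤ p)
    (hp : min 1 p ≤ ν.real B) (hKJ : K ≤ J.card) (hK : 4 * K ≤ p * J.card) :
    (Measure.pi fun _ : ι => ν).real
        {ω | ∑ i ∈ J, B.indicator (fun _ => (1 : ℝ)) (ω i) < K} ≤ Real.exp (-K) := by
  -- If the cap is active, almost every coordinate lies in `B` and the count is `J.card ≥ K`; the
  -- strict inequality in the event makes it null.
  rcases le_total 1 p with h1 | h1
  · rw [min_eq_left h1] at hp
    have hae : ∀ᵐ y ∂ν, y ∈ B := by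
      have hBr : ν.real B = 1 := le_antisymm measureReal_le_one hp
      have hc : ν.real Bᶜ = 0 := by rw [measureReal_compl hB, hBr]; simp
      exact (measureReal_eq_zero_iff (measure_ne_top _ _)).1 hc
    have hae' : ∀ᵐ ω ∂(Measure.pi fun _ : ι => ν), ∀ i, ω i ∈ B :=
      ae_all_iff.2 fun i =>
        (measurePreserving_eval (fun _ : ι => ν) i).quasiMeasurePreserving.ae hae
    have : (Measure.pi fun _ : ι => ν)
        {ω | ∑ i ∈ J, B.indicator (fun _ => (1 : ℝ)) (ω i) < K} = 0 := by
      refine measure_mono_null (fun ω hω => ?_) hae'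
      simp only [mem_compl_iff, mem_ofPred_eq] at hω ⊢
      intro hall
      have : ∑ i ∈ J, B.indicator (fun _ => (1 : ℝ)) (ω i) = J.card := by
        simp [indicator_of_mem (hall _)]
      linarith
    rw [measureReal_def, this]
    simpa using (Real.exp_pos _).le
  · rw [min_eq_right h1] at hp
    have hsub : {ω : ι → Ω | ∑ i ∈ J, B.indicator (fun _ => (1 : ℝ)) (ω i) < K} ⊆
        {ω | ∑ i ∈ J, B.indicator (fun _ => (1 : ℝ)) (ω i) ≤ K} := by
      intro ω hω
      rw [mem_ofPred_eq] at hω ⊢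
      exact hω.le
    -- With `θ = exp (-1)` the bound is at most `exp (K - p * J.card / 2)`, and `4 * K ≤ p * J.card`
    -- concludes.
    refine (measureReal_mono (μ := Measure.pi fun _ : ι => ν) hsub).trans
      ((measureReal_pi_count_le ν hB J hp (θ := Real.exp (-1)) (Real.exp_pos _) ?_ K).trans ?_)
    · exact Real.exp_le_one_iff.2 (by norm_num)
    · have he : Real.exp (-1) ≤ 1 / 2 := by
        rw [Real.exp_neg, one_div]
        exact inv_anti₀ (by norm_num) (by linarith [Real.add_one_le_exp (1 : ℝ)])
      rw [← Real.exp_mul]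
      have hb : 1 - p * (1 - Real.exp (-1)) ≤ Real.exp (-(p / 2)) := by
        have := Real.add_one_le_exp (-(p / 2))
        nlinarith
      have hb0 : 0 ≤ 1 - p * (1 - Real.exp (-1)) := by
        nlinarith [Real.exp_pos (-1)]
      calc _ ≤ Real.exp (-1 * -K) * Real.exp (-(p / 2)) ^ J.card := by gcongr
        _ ≤ _ := by
          rw [← Real.exp_nat_mul, ← Real.exp_add]
          refine Real.exp_le_exp.2 ?_
          nlinarith

end TailBounds

/-! ### Combinatorics of neighbor ranks and majority votes. -/

section NearestNeighbors

variable {X : Type*} [MetricSpace X]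

theorem nnRank_lt_nnRank {n : ℕ} (D : Fin n → X × Bool) (x : X) {i j : Fin n}
    (h : dist x (D i).1 < dist x (D j).1 ∨ (dist x (D i).1 = dist x (D j).1 ∧ i < j)) :
    nnRank D x i < nnRank D x j := by
  refine Finset.card_lt_card (Finset.ssubset_iff_of_subset ?_ |>.2 ⟨i, ?_, ?_⟩)
  · intro l hl
    simp only [Finset.mem_filter, Finset.mem_univ, true_and] at hl ⊢
    rcases h with h | ⟨h, h'⟩ <;> rcases hl with hl | ⟨hl, hl'⟩
    · exact Or.inl (hl.trans h)
    · exact Or.inl (hl ▸ h)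
    · exact Or.inl (h ▸ hl)
    · exact Or.inr ⟨hl.trans h, hl'.trans h'⟩
  · simpa using h
  · simp

theorem nnRank_injective {n : ℕ} (D : Fin n → X × Bool) (x : X) :
    Function.Injective (nnRank D x) := by
  intro i j hij
  by_contra hne
  rcases lt_trichotomy (dist x (D i).1) (dist x (D j).1) with h | h | h
  · exact (nnRank_lt_nnRank D x (Or.inl h)).ne hij
  · rcases lt_or_gt_of_ne hne with h' | h'
    · exact (nnRank_lt_nnRank D x (Or.inr ⟨h, h'⟩)).ne hij
    · exact (nnRank_lt_nnRank D x (Or.inr ⟨h.symm, h'⟩)).ne' hij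
  · exact (nnRank_lt_nnRank D x (Or.inl h)).ne' hij

theorem nnRank_lt {n : ℕ} (D : Fin n → X × Bool) (x : X) (i : Fin n) : nnRank D x i < n := by
  have : nnRank D x i < (Finset.univ : Finset (Fin n)).card :=
    Finset.card_lt_card (Finset.ssubset_univ_iff.2 fun h => by
      have := h ▸ Finset.mem_univ i
      simp at this)
  simpa using this

/-- Tie-breaking by index makes the order strict and total, so the ranks are exactly `0, …, n - 1`,
each taken once. -/
theorem card_kNearest {n k : ℕ} (D : Fin n → X × Bool) (x : X) (hk : k ≤ n) :
    (kNearest D k x).card = k := by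
  have himg : Finset.univ.image (nnRank D x) = Finset.range n :=
    Finset.eq_of_subset_of_card_le
      (fun r hr => by
        obtain ⟨i, -, rfl⟩ := Finset.mem_image.1 hr
        exact Finset.mem_range.2 (nnRank_lt D x i))
      (by rw [Finset.card_image_of_injective _ (nnRank_injective D x)]; simp)
  have himg' : (kNearest D k x).image (nnRank D x) = Finset.range k := by
    ext r
    simp only [kNearest, Finset.mem_image, Finset.mem_filter, Finset.mem_univ, true_and,
      Finset.mem_range]
    constructor
    · rintro ⟨i, hi, rfl⟩
      exact hi
    · intro hr
      have : r ∈ Finset.univ.image (nnRank D x) := by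
        rw [himg]
        exact Finset.mem_range.2 (hr.trans_le hk)
      obtain ⟨i, -, rfl⟩ := Finset.mem_image.1 this
      exact ⟨i, hr, rfl⟩
  rw [← Finset.card_image_of_injective _ (nnRank_injective D x), himg', Finset.card_range]

/-- If at least `k` sample points lie in a ball around `x`, then so do the `k` nearest neighbors
of `x`. -/
theorem dist_le_of_mem_kNearest {n k : ℕ} (D : Fin n → X × Bool) (x : X) {r : ℝ}
    (h : k ≤ (Finset.univ.filter fun i => dist x (D i).1 ≤ r).card) {i : Fin n}
    (hi : i ∈ kNearest D k x) : dist x (D i).1 ≤ r := by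
  by_contra hr
  push Not at hr
  simp only [kNearest, Finset.mem_filter, Finset.mem_univ, true_and] at hi
  refine (h.trans (Finset.card_le_card fun l hl => ?_)).not_gt hi
  simp only [Finset.mem_filter, Finset.mem_univ, true_and] at hl ⊢
  exact Or.inl (hl.trans_lt hr)

theorem exists_nearestNeighbor_eq {m : ℕ} [NeZero m] (D : Fin m → X × Bool) (x : X) :
    ∃ i, nearestNeighbor D x = (D i).1 ∧ ∀ l, dist x (D i).1 ≤ dist x (D l).1 := by
  refine ⟨_, rfl, fun l => ?_⟩
  by_contra h
  push Not at h
  have := nnRank_lt_nnRank D x (Or.inl h)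
  rw [(exists_nnRank_eq_zero D x).choose_spec] at this
  omega

/-- If at least half of the blocks vote wrongly and less than a quarter of them are exceptional,
then the blocks with a wrong vote that are not exceptional make up a quarter of all blocks, and at
most half of the selected indices in those blocks have their coordinate in `B`. -/
theorem exists_blocks {s n k : ℕ} {ι : Type*} (T : Fin s → Finset (Fin n)) (B : Set ι)
    (U : Fin s × Fin n → ι) (W R : Finset (Fin s)) (hW : s ≤ 2 * W.card)
    (hR : 4 * R.card < s)
    (h : ∀ j ∈ W, j ∉ R → ∑ i ∈ T j, B.indicator (fun _ => (1 : ℝ)) (U (j, i)) ≤ k / 2) :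
    ∃ S : Finset (Fin s), s ≤ 4 * S.card ∧
      ∑ a ∈ Finset.univ.filter (fun a : Fin s × Fin n => a.1 ∈ S ∧ a.2 ∈ T a.1),
        B.indicator (fun _ => (1 : ℝ)) (U a) ≤ (S.card * k : ℕ) / 2 := by
  refine ⟨W \ R, ?_, ?_⟩
  · have := Finset.le_card_sdiff R W
    omega
  · rw [Finset.sum_finset_product _ (W \ R) T (by simp)]
    calc _ ≤ ∑ j ∈ W \ R, (k : ℝ) / 2 := Finset.sum_le_sum fun j hj => by
          rw [Finset.mem_sdiff] at hj
          exact h j hj.1 hj.2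
      _ = _ := by
        rw [Finset.sum_const, nsmul_eq_mul]
        push_cast
        ring

theorem card_filter_blocks {s n k : ℕ} (T : Fin s → Finset (Fin n)) (hT : ∀ j, (T j).card = k)
    (S : Finset (Fin s)) :
    (Finset.univ.filter (fun a : Fin s × Fin n => a.1 ∈ S ∧ a.2 ∈ T a.1)).card = S.card * k := by
  rw [Finset.card_eq_sum_ones, Finset.sum_finset_product _ S T (by simp)]
  simp [hT]

theorem knnClassifier_eq_false {n k : ℕ} (hk : 0 < k) (D : Fin n → X × Bool) (x : X)
    (h : knnClassifier D k x = false) :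
    ∑ i ∈ kNearest D k x, (if (D i).2 = true then (1 : ℝ) else 0) ≤ k / 2 := by
  have hk' : (0 : ℝ) < k := by exact_mod_cast hk
  rw [knnClassifier, decide_eq_false_iff_not, not_lt, labelAverage, div_le_iff₀ hk'] at h
  linarith

theorem knnClassifier_eq_true {n k : ℕ} (hk : 0 < k) (hkn : k ≤ n) (D : Fin n → X × Bool) (x : X)
    (h : knnClassifier D k x = true) :
    ∑ i ∈ kNearest D k x, (if (D i).2 = true then (0 : ℝ) else 1) ≤ k / 2 := by
  have hk' : (0 : ℝ) < k := by exact_mod_cast hk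
  rw [knnClassifier, decide_eq_true_iff, labelAverage, lt_div_iff₀ hk'] at h
  have : ∑ i ∈ kNearest D k x, (if (D i).2 = true then (0 : ℝ) else 1) =
      k - ∑ i ∈ kNearest D k x, (if (D i).2 = true then (1 : ℝ) else 0) := by
    rw [eq_sub_iff_add_eq, ← Finset.sum_add_distrib]
    trans ∑ i ∈ kNearest D k x, (1 : ℝ)
    · exact Finset.sum_congr rfl fun i _ => by split_ifs <;> simp
    · simp [card_kNearest D x hkn]
  linarith

theorem bigNN_eq_false {s n k : ℕ} (hs : 0 < s) (D : Fin s × Fin n → X × Bool) (x : X)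
    (h : bigNN D k x = false) :
    s ≤ 2 * (Finset.univ.filter fun j => knnClassifier (fun i => D (j, i)) k x = false).card := by
  have hs' : (0 : ℝ) < s := by exact_mod_cast hs
  rw [bigNN, decide_eq_false_iff_not, not_lt, div_le_iff₀ hs', Finset.sum_boole] at h
  have hc := Finset.card_filter_add_card_filter_not (s := (Finset.univ : Finset (Fin s)))
    (fun j => knnClassifier (fun i => D (j, i)) k x = true)
  simp only [Bool.not_eq_true, Finset.card_univ, Fintype.card_fin] at hc
  have h2 : 2 * (Finset.univ.filter
      fun j => knnClassifier (fun i => D (j, i)) k x = true).card ≤ s := by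
    rw [← @Nat.cast_le ℝ]
    push_cast
    linarith
  omega

theorem bigNN_eq_true {s n k : ℕ} (hs : 0 < s) (D : Fin s × Fin n → X × Bool) (x : X)
    (h : bigNN D k x = true) :
    s ≤ 2 * (Finset.univ.filter fun j => knnClassifier (fun i => D (j, i)) k x = true).card := by
  have hs' : (0 : ℝ) < s := by exact_mod_cast hs
  rw [bigNN, decide_eq_true_iff, lt_div_iff₀ hs', Finset.sum_boole] at h
  rw [← @Nat.cast_le ℝ]
  push_cast
  linarith

end NearestNeighbors

/-! ### Measurability of the classifiers. -/

section Measurability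

variable {X : Type*} [MetricSpace X] [TopologicalSpace.SeparableSpace X] [MeasurableSpace X]
  [BorelSpace X] {Ω : Type*} [MeasurableSpace Ω]

theorem measurable_nnRank {n : ℕ} {D : Ω → Fin n → X × Bool} {x : Ω → X} (hD : Measurable D)
    (hx : Measurable x) (i : Fin n) : Measurable fun ω => nnRank (D ω) (x ω) i := by
  have : SecondCountableTopology X := UniformSpace.secondCountable_of_separable X
  have hdist : ∀ l, Measurable fun ω => dist (x ω) (D ω l).1 := fun l =>
    hx.dist (measurable_fst.comp ((measurable_pi_apply l).comp hD))
  simp only [nnRank, Finset.card_filter]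
  refine Finset.measurable_sum _ fun l _ => Measurable.ite ?_ measurable_const measurable_const
  refine (measurableSet_lt (hdist l) (hdist i)).union
    ((measurableSet_eq_fun (hdist l) (hdist i)).inter (MeasurableSet.const _))

theorem measurable_knnClassifier {n : ℕ} {D : Ω → Fin n → X × Bool} {x : Ω → X}
    (hD : Measurable D) (hx : Measurable x) (k : ℕ) :
    Measurable fun ω => knnClassifier (D ω) k (x ω) := by
  refine measurable_to_bool ?_
  have : Measurable fun ω => labelAverage (D ω) k (x ω) := by
    simp only [labelAverage, kNearest, Finset.sum_filter]
    refine Measurable.div_const (Finset.measurable_sum _ fun i _ =>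
      Measurable.ite ?_ (Measurable.ite ?_ measurable_const measurable_const) measurable_const) _
    · exact measurableSet_lt (measurable_nnRank hD hx i) measurable_const
    · exact (measurable_snd.comp ((measurable_pi_apply i).comp hD)) (measurableSet_singleton true)
  convert measurableSet_lt (measurable_const (a := (1 / 2 : ℝ))) this using 1
  ext ω
  simp [knnClassifier]

theorem measurable_bigNN {s n : ℕ} {D : Ω → Fin s × Fin n → X × Bool} {x : Ω → X}
    (hD : Measurable D) (hx : Measurable x) (k : ℕ) :
    Measurable fun ω => bigNN (D ω) k (x ω) := by
  refine measurable_to_bool ?_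
  have : Measurable fun ω => (∑ j : Fin s,
      if knnClassifier (fun i => D ω (j, i)) k (x ω) = true then (1 : ℝ) else 0) / s := by
    refine Measurable.div_const (Finset.measurable_sum _ fun j _ =>
      Measurable.ite ?_ measurable_const measurable_const) _
    exact measurable_knnClassifier (measurable_pi_lambda _ fun i =>
      (measurable_pi_apply (j, i)).comp hD) hx k (measurableSet_singleton true)
  convert measurableSet_lt (measurable_const (a := (1 / 2 : ℝ))) this using 1
  ext ω
  simp [bigNN]

/-- The chosen index is the only one of rank zero, so its level sets are level sets of measurable
rank functions. -/
theorem measurable_nearestNeighbor {m : ℕ} [NeZero m] (D : Fin m → X × Bool) :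
    Measurable (nearestNeighbor D) := by
  have h : Measurable fun x => (exists_nnRank_eq_zero D x).choose := by
    refine measurable_to_countable' fun i => ?_
    convert measurable_nnRank (measurable_const (a := D)) measurable_id i
      (measurableSet_singleton 0) using 1
    ext x
    simp only [mem_preimage, mem_singleton_iff, id]
    constructor
    · rintro rfl
      exact (exists_nnRank_eq_zero D x).choose_spec
    · intro hx
      exact nnRank_injective D x ((exists_nnRank_eq_zero D x).choose_spec.trans hx.symm)
  exact (measurable_of_countable fun i => (D i).1).comp h

theorem measurable_denoisedBigNN {s n m : ℕ} [NeZero m] (D : Fin s × Fin n → X × Bool) (k : ℕ)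
    (e : Fin m ↪ Fin s × Fin n) : Measurable (denoisedBigNN D k e) :=
  measurable_bigNN measurable_const (measurable_nearestNeighbor _) k

end Measurability

/-! ### Integral formula for the regret. -/

section Regret

variable {X : Type*} [MeasurableSpace X] {P : Measure (X × Bool)} [IsProbabilityMeasure P]
  {η : X → ℝ}

theorem IsRegressionFunction.integrable (h : IsRegressionFunction P η) : Integrable η P.fst := by
  refine Integrable.of_bound h.measurable.aestronglyMeasurable 1 (ae_of_all _ fun x => ?_)
  rw [Real.norm_of_nonneg (h.nonneg x)]
  exact h.le_one x

theorem measureReal_prod_false (h : IsRegressionFunction P η) {A : Set X} (hA : MeasurableSet A) :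
    P.real (A ×ˢ {false}) = ∫ x in A, (1 - η x) ∂P.fst := by
  have hu : P.real (A ×ˢ {true}) + P.real (A ×ˢ {false}) = P.fst.real A := by
    rw [measureReal_def P.fst, Measure.fst_apply hA, ← measureReal_def,
      ← measureReal_union _ (hA.prod (measurableSet_singleton _))]
    · congr 1
      ext ⟨x, b⟩
      cases b <;> simp
    · rw [disjoint_left]
      rintro ⟨x, b⟩ h1 h2
      simp_all
  rw [integral_sub (integrable_const _) h.integrable.integrableOn, ← h.setIntegral_eq A hA]
  simp only [integral_const, smul_eq_mul, mul_one, measureReal_restrict_apply_univ]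
  linarith

theorem risk_eq_integral (h : IsRegressionFunction P η) {g : X → Bool} (hg : Measurable g) :
    risk P g = ∫ x, (if g x = true then 1 - η x else η x) ∂P.fst := by
  have hT : MeasurableSet {x | g x = true} := hg (measurableSet_singleton true)
  have hset : {z : X × Bool | g z.1 ≠ z.2} =
      {x | g x = true} ×ˢ {false} ∪ {x | g x = true}ᶜ ×ˢ {true} := by
    ext ⟨x, b⟩
    cases b <;> simp
  have hite : (fun x => if g x = true then 1 - η x else η x) =
      {x | g x = true}.piecewise (fun x => 1 - η x) η := by
    ext x
    simp [piecewise]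
  rw [risk, hset, measureReal_union _ (hT.compl.prod (measurableSet_singleton _)),
    measureReal_prod_false h hT, h.setIntegral_eq _ hT.compl, hite, integral_piecewise hT]
  · exact ((integrable_const _).sub h.integrable).integrableOn
  · exact h.integrable.integrableOn
  · rw [disjoint_left]
    rintro ⟨x, b⟩ h1 h2
    simp_all

omit [IsProbabilityMeasure P] in
theorem measurable_bayesClassifier (h : IsRegressionFunction P η) :
    Measurable (bayesClassifier η) := by
  refine measurable_to_bool ?_
  convert measurableSet_lt (measurable_const (a := (1 / 2 : ℝ))) h.measurable using 1
  ext ω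
  simp [bayesClassifier]

/-- The conditional error at `x` is `η x` or `1 - η x`; choosing the larger instead of the smaller
costs `2 * |η x - 1 / 2|`. -/
theorem regret_eq_integral (h : IsRegressionFunction P η) {g : X → Bool} (hg : Measurable g) :
    regret P η g =
      ∫ x, (if g x = bayesClassifier η x then 0 else 2 * |η x - 1 / 2|) ∂P.fst := by
  have hint : ∀ g : X → Bool, Measurable g →
      Integrable (fun x => if g x = true then 1 - η x else η x) P.fst := fun g hg => by
    refine Integrable.of_bound (Measurable.ite (hg (measurableSet_singleton true))
      (h.measurable.const_sub 1) h.measurable).aestronglyMeasurable 1 (ae_of_all _ fun x => ?_)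
    have := h.nonneg x
    have := h.le_one x
    rw [Real.norm_eq_abs, abs_le]
    split_ifs <;> constructor <;> linarith
  rw [regret, risk_eq_integral h hg, risk_eq_integral h (measurable_bayesClassifier h),
    ← integral_sub (hint g hg) (hint _ (measurable_bayesClassifier h))]
  refine integral_congr_ae (ae_of_all _ fun x => ?_)
  by_cases hx : 1 / 2 < η x
  · have hb : bayesClassifier η x = true := by simpa [bayesClassifier] using hx
    simp only [hb]
    rw [abs_of_pos (by linarith)]
    cases g x <;> simp
    ring
  · have hb : bayesClassifier η x = false := by simpa [bayesClassifier] using hx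
    simp only [hb]
    rw [abs_of_nonpos (by linarith)]
    cases g x <;> simp
    ring

theorem regret_nonneg (h : IsRegressionFunction P η) {g : X → Bool} (hg : Measurable g) :
    0 ≤ regret P η g := by
  rw [regret_eq_integral h hg]
  refine integral_nonneg fun x => ?_
  dsimp only [Pi.zero_apply]
  split_ifs <;> positivity

/-- A classifier that agrees with the Bayes classifier where `η` is not `t`-close to `1 / 2`
has a small regret. -/
theorem regret_le (h : IsRegressionFunction P η) {g : X → Bool} (hg : Measurable g) {t : ℝ}
    (ht : 0 ≤ t) (hgt : ∀ x, t < |η x - 1 / 2| → g x = bayesClassifier η x) :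
    regret P η g ≤ 2 * t * P.fst.real {x | |η x - 1 / 2| ≤ t} := by
  have hS : MeasurableSet {x | |η x - 1 / 2| ≤ t} :=
    measurableSet_le (by simpa using (h.measurable.sub_const _).abs) measurable_const
  rw [regret_eq_integral h hg, mul_comm, ← smul_eq_mul, ← integral_indicator_const _ hS]
  refine integral_mono_of_nonneg (ae_of_all _ fun x => ?_) ((integrable_const _).indicator hS)
    (ae_of_all _ fun x => ?_)
  · dsimp only [Pi.zero_apply]
    split_ifs <;> positivity
  · dsimp only
    by_cases hx : |η x - 1 / 2| ≤ t
    · rw [indicator_of_mem (by exact hx)]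
      split_ifs
      · positivity
      · linarith
    · rw [if_pos (hgt x (not_le.1 hx))]
      exact indicator_nonneg (fun _ _ => by positivity) x

end Regret

/-! ### Labels as thresholded uniform variables. -/

section Coupling

/-- The uniform distribution on the unit interval. -/
noncomputable def uniformUnit : Measure ℝ := volume.restrict (Icc 0 1)

instance : IsProbabilityMeasure uniformUnit := ⟨by simp [uniformUnit]⟩

theorem uniformUnit_Iic {t : ℝ} (ht : t ≤ 1) : uniformUnit (Iic t) = ENNReal.ofReal t := by
  have : Iic t ∩ Icc 0 1 = Icc 0 t := by
    ext u
    simp only [mem_inter_iff, mem_Iic, mem_Icc]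
    constructor
    · rintro ⟨h1, h2, -⟩
      exact ⟨h2, h1⟩
    · rintro ⟨h1, h2⟩
      exact ⟨h2, h1, h2.trans ht⟩
  rw [uniformUnit, Measure.restrict_apply measurableSet_Iic, this, Real.volume_Icc, sub_zero]

theorem uniformUnit_real_Iic {t : ℝ} (ht0 : 0 ≤ t) (ht : t ≤ 1) : uniformUnit.real (Iic t) = t := by
  rw [measureReal_def, uniformUnit_Iic ht, ENNReal.toReal_ofReal ht0]

theorem uniformUnit_real_Ioi {t : ℝ} (ht0 : 0 ≤ t) (ht : t ≤ 1) :
    uniformUnit.real (Ioi t) = 1 - t := by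
  rw [← compl_Iic, measureReal_compl measurableSet_Iic, uniformUnit_real_Iic ht0 ht]
  simp

variable {X : Type*} [MeasurableSpace X] {P : Measure (X × Bool)} [IsProbabilityMeasure P]
  {η : X → ℝ}

/-- Attaches to `x` the label `1` if the number `u` is at most `η x`. -/
noncomputable def thresholdLabel (η : X → ℝ) (z : X × ℝ) : X × Bool := (z.1, decide (z.2 ≤ η z.1))

theorem measurable_thresholdLabel (hη : Measurable η) : Measurable (thresholdLabel η) := by
  refine measurable_fst.prodMk (measurable_to_bool ?_)
  convert measurableSet_le (measurable_snd (α := X)) (hη.comp (measurable_fst (β := ℝ))) using 1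
  ext ω
  simp

/-- Given `x`, the event `u ≤ η x` has probability `η x`, which gives the right mass to label 1.
Label 0 follows by subtraction from the marginal, and two label slices make up every measurable set.
-/
theorem map_thresholdLabel (h : IsRegressionFunction P η) :
    (P.fst.prod uniformUnit).map (thresholdLabel η) = P := by
  have hm := measurable_thresholdLabel h.measurable
  have htrue : ∀ A : Set X, MeasurableSet A →
      (P.fst.prod uniformUnit).map (thresholdLabel η) (A ×ˢ {true}) = P (A ×ˢ {true}) := by
    intro A hA
    have hAt : MeasurableSet (A ×ˢ ({true} : Set Bool)) := hA.prod (measurableSet_singleton _)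
    rw [Measure.map_apply hm hAt, Measure.prod_apply (hm hAt)]
    have hsec : ∀ x, uniformUnit (Prod.mk x ⁻¹' (thresholdLabel η ⁻¹' (A ×ˢ {true}))) =
        A.indicator (fun x => ENNReal.ofReal (η x)) x := by
      intro x
      by_cases hx : x ∈ A
      · rw [indicator_of_mem hx, ← uniformUnit_Iic (h.le_one x)]
        congr 1
        ext u
        simp [thresholdLabel, hx]
      · rw [indicator_of_notMem hx]
        convert measure_empty (μ := uniformUnit)
        ext u
        simp [thresholdLabel, hx]
    simp only [hsec]
    rw [lintegral_indicator hA, ← ofReal_integral_eq_lintegral_ofReal h.integrable.integrableOn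
      (ae_of_all _ h.nonneg), ← h.setIntegral_eq A hA, measureReal_def,
      ENNReal.ofReal_toReal (measure_ne_top _ _)]
  have huniv : ∀ A : Set X, MeasurableSet A →
      (P.fst.prod uniformUnit).map (thresholdLabel η) (A ×ˢ univ) = P (A ×ˢ univ) := by
    intro A hA
    rw [Measure.map_apply hm (hA.prod MeasurableSet.univ)]
    have : thresholdLabel η ⁻¹' (A ×ˢ univ) = A ×ˢ univ := by
      ext z
      simp only [mem_preimage, mem_prod, mem_univ, and_true, thresholdLabel]
    rw [this, Measure.prod_prod, measure_univ, mul_one, Measure.fst_apply hA]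
    congr 1
    ext z
    simp
  have hfalse : ∀ A : Set X, MeasurableSet A →
      (P.fst.prod uniformUnit).map (thresholdLabel η) (A ×ˢ {false}) = P (A ×ˢ {false}) := by
    intro A hA
    have hAt : MeasurableSet (A ×ˢ ({true} : Set Bool)) := hA.prod (measurableSet_singleton _)
    have hd : A ×ˢ ({false} : Set Bool) = A ×ˢ univ \ A ×ˢ {true} := by
      ext ⟨x, b⟩
      cases b <;> simp
    have hsub : A ×ˢ ({true} : Set Bool) ⊆ A ×ˢ univ := prod_mono_right (subset_univ _)
    have := Measure.isProbabilityMeasure_map (μ := P.fst.prod uniformUnit) hm.aemeasurable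
    rw [hd, measure_sdiff hsub hAt.nullMeasurableSet (measure_ne_top _ _),
      measure_sdiff hsub hAt.nullMeasurableSet (measure_ne_top _ _), htrue A hA, huniv A hA]
  ext s hs
  have hsec : ∀ b : Bool, MeasurableSet {x | (x, b) ∈ s} := fun b =>
    measurable_prodMk_right hs
  have hsu : s = {x | (x, true) ∈ s} ×ˢ {true} ∪ {x | (x, false) ∈ s} ×ˢ {false} := by
    ext ⟨x, b⟩
    cases b <;> simp
  have hdisj : Disjoint ({x | (x, true) ∈ s} ×ˢ {true}) ({x | (x, false) ∈ s} ×ˢ {false}) := by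
    rw [disjoint_left]
    rintro ⟨x, b⟩ h1 h2
    have h3 := h1.2.symm.trans h2.2
    simp at h3
  rw [hsu, measure_union hdisj ((hsec _).prod (measurableSet_singleton _)),
    measure_union hdisj ((hsec _).prod (measurableSet_singleton _)), htrue _ (hsec _),
    hfalse _ (hsec _)]

variable {ι : Type*} [Fintype ι]

/-- A bound for the probability of an event on which the labels are conditionally unlikely, given
the positions of the sample points. -/
theorem measureReal_pi_le_add (h : IsRegressionFunction P η) {B : Set (ι → X × Bool)}
    (hB : MeasurableSet B) (R : Set (ι → X)) {c : ℝ} (hc : 0 ≤ c)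
    (hR : ∀ xs, xs ∉ R → (Measure.pi fun _ : ι => uniformUnit).real
      {us | (fun a => thresholdLabel η (xs a, us a)) ∈ B} ≤ c) :
    (Measure.pi fun _ : ι => P).real B ≤ (Measure.pi fun _ : ι => P.fst).real R + c := by
  have hm := measurable_thresholdLabel h.measurable
  have hmp : MeasurePreserving (thresholdLabel η) (P.fst.prod uniformUnit) P :=
    ⟨hm, map_thresholdLabel h⟩
  have hmp2 := measurePreserving_pi (fun _ : ι => P.fst.prod uniformUnit) (fun _ : ι => P)
    (fun _ => hmp)
  -- Independent pairs are regrouped into a vector of positions and an independent vector of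
  -- uniforms, so that Fubini conditions on the positions.
  have hmp3 := (measurePreserving_arrowProdEquivProdArrow X ℝ ι (fun _ => P.fst)
    (fun _ => uniformUnit)).symm
  have hmp4 := hmp2.comp hmp3
  have hpre := hmp4.measure_preimage hB.nullMeasurableSet
  rw [Measure.prod_apply (hmp4.measurable hB)] at hpre
  have key : (Measure.pi fun _ : ι => P) B ≤
      (Measure.pi fun _ : ι => P.fst) R + ENNReal.ofReal c := by
    rw [← hpre]
    -- On `R` the conditional probability is bounded by 1, off `R` by `c`. The last step only needs
    -- an upper bound for the integral of the indicator, so `R` may be any set.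
    calc _ ≤ ∫⁻ xs, (R.indicator (fun _ => 1) xs + ENNReal.ofReal c)
          ∂(Measure.pi fun _ : ι => P.fst) := by
          refine lintegral_mono fun xs => ?_
          by_cases hxs : xs ∈ R
          · rw [indicator_of_mem hxs]
            exact prob_le_one.trans le_self_add
          · rw [indicator_of_notMem hxs, zero_add]
            refine ENNReal.le_ofReal_iff_toReal_le (measure_ne_top _ _) hc |>.2 ?_
            exact hR xs hxs
      _ = (∫⁻ xs, R.indicator (fun _ => 1) xs ∂(Measure.pi fun _ : ι => P.fst)) +
            ENNReal.ofReal c := by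
          rw [lintegral_add_right _ measurable_const]
          simp
      _ ≤ _ := by
          gcongr
          simpa using lintegral_indicator_const_le (μ := Measure.pi fun _ : ι => P.fst) R 1
  rw [measureReal_def, measureReal_def]
  refine ENNReal.toReal_le_of_le_ofReal (by positivity) (key.trans ?_)
  rw [ENNReal.ofReal_add ENNReal.toReal_nonneg hc, ENNReal.ofReal_toReal (measure_ne_top _ _)]

end Coupling

/-! ### Redrawing one coordinate of an independent sample. -/

section Update

variable {ι X : Type*} [Fintype ι] [DecidableEq ι] [MeasurableSpace X]

theorem measurePreserving_update (μ : Measure X) [IsProbabilityMeasure μ] (a : ι) :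
    MeasurePreserving (fun p : (ι → X) × X => Function.update p.1 a p.2)
      ((Measure.pi fun _ : ι => μ).prod μ) (Measure.pi fun _ : ι => μ) := by
  have hm : Measurable fun p : (ι → X) × X => Function.update p.1 a p.2 :=
    measurable_pi_lambda _ fun i => by
      by_cases hi : i = a
      · subst hi
        simpa using measurable_snd
      · simpa [Function.update_of_ne hi, Function.comp_def] using
          (measurable_pi_apply i).comp (measurable_fst (α := ι → X) (β := X))
  refine ⟨hm, (Measure.pi_eq fun s hs => ?_).symm⟩
  rw [Measure.map_apply hm (MeasurableSet.univ_pi hs)]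
  have : (fun p : (ι → X) × X => Function.update p.1 a p.2) ⁻¹' univ.pi s =
      (univ.pi (Function.update s a univ)) ×ˢ s a := by
    ext ⟨xs, x⟩
    simp only [mem_preimage, mem_pi, mem_univ, forall_true_left, mem_prod]
    constructor
    · intro hx
      refine ⟨fun i => ?_, by simpa using hx a⟩
      by_cases hi : i = a
      · subst hi
        simp
      · simpa [Function.update_of_ne hi] using hx i
    · rintro ⟨h1, h2⟩ i
      by_cases hi : i = a
      · subst hi
        simpa using h2
      · simpa [Function.update_of_ne hi] using h1 i
  rw [this, Measure.prod_prod, Measure.pi_pi, ← Finset.mul_prod_erase _ _ (Finset.mem_univ a),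
    ← Finset.mul_prod_erase _ (fun i => μ (s i)) (Finset.mem_univ a), Function.update_self,
    measure_univ, one_mul, mul_comm]
  congr 1
  exact Finset.prod_congr rfl fun i hi => by
    rw [Function.update_of_ne (Finset.ne_of_mem_erase hi)]

/-- Replacing coordinate `a` by an independent copy preserves the law. Conditioning on the copy
turns a sample point used as center into a fixed point. -/
theorem measureReal_pi_le_of_update (μ : Measure X) [IsProbabilityMeasure μ] (a : ι)
    {G : Set (ι → X)} (hG : MeasurableSet G) {c : ℝ} (hc : 0 ≤ c)
    (h : ∀ x, (Measure.pi fun _ : ι => μ).real {xs | Function.update xs a x ∈ G} ≤ c) :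
    (Measure.pi fun _ : ι => μ).real G ≤ c := by
  have hmp := measurePreserving_update (ι := ι) μ a
  refine ENNReal.toReal_le_of_le_ofReal hc ?_
  rw [← hmp.measure_preimage hG.nullMeasurableSet, Measure.prod_apply_symm (hmp.measurable hG)]
  calc _ ≤ ∫⁻ _, ENNReal.ofReal c ∂μ := lintegral_mono fun x =>
        (ENNReal.le_ofReal_iff_toReal_le (measure_ne_top _ _) hc).2 (h x)
    _ = _ := by simp

end Update

/-! ### Packing and nets. -/

section Net

variable {X : Type*} [MetricSpace X] [MeasurableSpace X] [BorelSpace X]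

/-- A measure with an intrinsic dimension has finite nets of controlled size. -/
theorem HasIntrinsicDim.exists_net {μ : Measure X} [IsProbabilityMeasure μ] {d' : ℕ} {Cd r : ℝ}
    (h : HasIntrinsicDim μ d' Cd) (hCd : 0 < Cd) (hr : 0 < r) :
    ∃ F : Finset X, F.card * min 1 (Cd * r ^ d') ≤ 1 ∧ ∀ x, ∃ z ∈ F, dist z x ≤ 2 * r := by
  classical
  set q := min 1 (Cd * r ^ d') with hq
  have hq0 : 0 < q := lt_min one_pos (by positivity)
  let Sep : Finset X → Prop := fun F => ∀ x ∈ F, ∀ y ∈ F, x ≠ y → 2 * r < dist x y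
  have hcard : ∀ F, Sep F → F.card * q ≤ 1 := by
    intro F hF
    have hd : (F : Set X).PairwiseDisjoint fun x => Metric.closedBall x r := by
      intro x hx y hy hxy
      exact Metric.closedBall_disjoint_closedBall (by linarith [hF x hx y hy hxy])
    calc F.card * q = ∑ _x ∈ F, q := by simp
      _ ≤ ∑ x ∈ F, μ.real (Metric.closedBall x r) := Finset.sum_le_sum fun x _ => h x r hr
      _ = μ.real (⋃ x ∈ F, Metric.closedBall x r) :=
        (measureReal_biUnion_finset hd fun x _ => measurableSet_closedBall).symm
      _ ≤ 1 := measureReal_le_one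
  -- Disjoint balls of mass at least `q` bound the size of separated sets, so one of maximal
  -- cardinality exists; maximality makes it a net.
  have hbdd : BddAbove {c | ∃ F, Sep F ∧ F.card = c} := by
    refine ⟨⌊1 / q⌋₊, ?_⟩
    rintro _ ⟨F, hF, rfl⟩
    exact Nat.le_floor ((le_div_iff₀ hq0).2 (hcard F hF))
  obtain ⟨F, hF, hFc⟩ := Nat.sSup_mem (s := {c | ∃ F, Sep F ∧ F.card = c})
    ⟨0, ∅, by simp [Sep], rfl⟩ hbdd
  refine ⟨F, hcard F hF, fun x => ?_⟩
  by_contra hx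
  push Not at hx
  have hxF : x ∉ F := fun hxF => by
    have := hx x hxF
    rw [dist_self] at this
    linarith
  have hSep : Sep (insert x F) := by
    intro y hy z hz hyz
    rw [Finset.mem_insert] at hy hz
    rcases hy with rfl | hy <;> rcases hz with rfl | hz
    · exact absurd rfl hyz
    · rw [dist_comm]
      exact hx z hz
    · exact hx y hy
    · exact hF y hy z hz hyz
  have := le_csSup hbdd ⟨_, hSep, rfl⟩
  rw [Finset.card_insert_of_notMem hxF] at this
  omega

end Net

/-! ### Probability that all selected coordinates lie in a given set. -/

section Miss

theorem measureReal_pi_forall_mem {ι κ Ω : Type*} [Fintype ι] [Fintype κ] [MeasurableSpace Ω]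
    (ν : Measure Ω) [IsProbabilityMeasure ν] (e : κ ↪ ι) (B : Set Ω) :
    (Measure.pi fun _ : ι => ν).real {ω | ∀ i, ω (e i) ∈ B} = ν.real B ^ Fintype.card κ := by
  classical
  have : {ω : ι → Ω | ∀ i, ω (e i) ∈ B} =
      univ.pi fun a => if a ∈ Finset.univ.map e then B else univ := by
    ext ω
    simp only [mem_ofPred_eq, mem_pi, mem_univ, forall_true_left]
    constructor
    · intro h a
      split_ifs with ha
      · obtain ⟨i, -, rfl⟩ := Finset.mem_map.1 ha
        exact h i
      · trivial
    · intro h i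
      simpa using h (e i)
  rw [this, measureReal_def, Measure.pi_pi]
  simp only [apply_ite ν, measure_univ]
  rw [Finset.prod_ite_mem, Finset.univ_inter, Finset.prod_map, Finset.prod_const, Finset.card_univ,
    ENNReal.toReal_pow, measureReal_def]

end Miss

/-! ### Union bound over large sets of blocks. -/

section Union

theorem measureReal_exists_finset_le {Ω : Type*} [MeasurableSpace Ω] (ν : Measure Ω)
    [IsFiniteMeasure ν] {s : ℕ} (E : Finset (Fin s) → Set Ω) {c : ℝ} (hc : 0 ≤ c)
    (h : ∀ S, s ≤ 4 * S.card → ν.real (E S) ≤ c) :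
    ν.real {ω | ∃ S, s ≤ 4 * S.card ∧ ω ∈ E S} ≤ 2 ^ s * c := by
  have hset : {ω | ∃ S, s ≤ 4 * S.card ∧ ω ∈ E S} =
      ⋃ S : Finset (Fin s), {ω | s ≤ 4 * S.card ∧ ω ∈ E S} := by
    ext ω
    simp
  rw [hset]
  refine (measureReal_iUnion_fintype_le _).trans ?_
  calc _ ≤ ∑ _S : Finset (Fin s), c := Finset.sum_le_sum fun S _ => by
        by_cases hS : s ≤ 4 * S.card
        · simpa [hS] using h S hS
        · simpa [hS] using hc
    _ = _ := by simp

end Union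

/-! ### Few blocks have fewer than `k` points near a sample location. -/

section Radius

variable {X : Type*} [MetricSpace X] [TopologicalSpace.SeparableSpace X] [MeasurableSpace X]
  [BorelSpace X]

/-- The center is itself a sample point, so its coordinate is redrawn. After the update that
coordinate is at distance 0 from the center, which can only raise the count; the tail bound for a
fixed center applies. -/
theorem measureReal_few_close {ι : Type*} [Fintype ι] [DecidableEq ι] (μ : Measure X)
    [IsProbabilityMeasure μ] (a : ι) (J : Finset ι) {r p K : ℝ} (hr : 0 ≤ r) (hp0 : 0 ≤ p)
    (hball : ∀ x, min 1 p ≤ μ.real (Metric.closedBall x r)) (hKJ : K ≤ J.card)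
    (hK : 4 * K ≤ p * J.card) :
    (Measure.pi fun _ : ι => μ).real
      {xs | ∑ b ∈ J, (Metric.closedBall (xs a) r).indicator (fun _ => (1 : ℝ)) (xs b) < K} ≤
      Real.exp (-K) := by
  have : SecondCountableTopology X := UniformSpace.secondCountable_of_separable X
  refine measureReal_pi_le_of_update μ a ?_ (Real.exp_pos _).le fun x => ?_
  · refine measurableSet_lt (Finset.measurable_sum _ fun b _ => ?_) measurable_const
    have hb : (fun xs : ι → X =>
        (Metric.closedBall (xs a) r).indicator (fun _ => (1 : ℝ)) (xs b)) =
        {xs : ι → X | dist (xs b) (xs a) ≤ r}.indicator fun _ => (1 : ℝ) := by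
      ext xs
      simp [indicator]
    rw [hb]
    exact measurable_const.indicator (measurableSet_le
      ((measurable_pi_apply b).dist (measurable_pi_apply a)) measurable_const)
  · refine (measureReal_mono fun xs hxs => ?_).trans
      (measureReal_pi_count_lt μ (Metric.isClosed_closedBall (x := x)).measurableSet J hp0
        (hball x) hKJ hK)
    rw [mem_ofPred_eq] at hxs ⊢
    refine lt_of_le_of_lt (Finset.sum_le_sum fun b _ => ?_) hxs
    rw [Function.update_self]
    by_cases hb : b = a
    · subst hb
      rw [Function.update_self, indicator_of_mem (Metric.mem_closedBall_self hr)]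
      exact indicator_le' (fun _ _ => le_rfl) (fun _ _ => zero_le_one) _
    · rw [Function.update_of_ne hb]

/-- The blocks of the configuration `xs` with fewer than `k` points at distance at most `r`
from `x`. -/
noncomputable def sparseBlocks {s n : ℕ} (xs : Fin s × Fin n → X) (k : ℕ) (r : ℝ) (x : X) :
    Finset (Fin s) :=
  Finset.univ.filter fun j => (Finset.univ.filter fun i => dist x (xs (j, i)) ≤ r).card < k

/-- If `S` is the set of sparse blocks, their union holds fewer than `S.card * k` close points
although the mean number is at least four times that when the cap is inactive. A union bound over
`S` with `S.card ≥ s / 4` follows. -/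
theorem measureReal_sparseBlocks_le {s n k : ℕ} (hs : 0 < s) (hkn : k ≤ n) (μ : Measure X)
    [IsProbabilityMeasure μ] (a : Fin s × Fin n) {r p : ℝ} (hr : 0 ≤ r) (hp0 : 0 ≤ p)
    (hball : ∀ x, min 1 p ≤ μ.real (Metric.closedBall x r)) (hk : 4 * k ≤ p * n) :
    (Measure.pi fun _ : Fin s × Fin n => μ).real
      {xs | s ≤ 4 * (sparseBlocks xs k r (xs a)).card} ≤ 2 ^ s * Real.exp (-(s * k / 4)) := by
  let J : Finset (Fin s) → Finset (Fin s × Fin n) := fun S =>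
    Finset.univ.filter fun b => b.1 ∈ S ∧ b.2 ∈ Finset.univ
  have hJ : ∀ S, (J S).card = S.card * n := fun S =>
    card_filter_blocks (fun _ => Finset.univ) (by simp) S
  refine (measureReal_mono ?_ (measure_ne_top _ _)).trans (measureReal_exists_finset_le
    (Measure.pi fun _ : Fin s × Fin n => μ) (fun S => {xs | ∑ b ∈ J S,
      (Metric.closedBall (xs a) r).indicator (fun _ => (1 : ℝ)) (xs b) < (S.card * k : ℕ)})
    (Real.exp_pos _).le fun S hS => ?_)
  · intro xs hxs
    rw [mem_ofPred_eq] at hxs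
    refine ⟨_, hxs, ?_⟩
    rw [mem_ofPred_eq, Finset.sum_finset_product (J _) (sparseBlocks xs k r (xs a))
      (fun _ => Finset.univ) (by simp [J])]
    have hne : (sparseBlocks xs k r (xs a)).Nonempty := by
      rw [← Finset.card_pos]
      omega
    calc _ < ∑ _j ∈ sparseBlocks xs k r (xs a), (k : ℝ) :=
          Finset.sum_lt_sum_of_nonempty hne fun j hj => by
            simp only [sparseBlocks, Finset.mem_filter, Finset.mem_univ, true_and] at hj
            calc _ = ((Finset.univ.filter fun i => dist (xs a) (xs (j, i)) ≤ r).card : ℝ) := by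
                  rw [← Finset.sum_boole]
                  refine Finset.sum_congr rfl fun i _ => ?_
                  simp [indicator, dist_comm]
              _ < k := by exact_mod_cast hj
      _ = _ := by simp
  · refine (measureReal_few_close μ a (J S) hr hp0 hball ?_ ?_).trans (Real.exp_le_exp.2 ?_)
    · rw [hJ]
      exact_mod_cast Nat.mul_le_mul_left _ hkn
    · rw [hJ]
      push_cast
      nlinarith [(Nat.cast_nonneg S.card : (0 : ℝ) ≤ S.card)]
    · have : (s : ℝ) ≤ 4 * S.card := by exact_mod_cast hS
      push_cast
      nlinarith [(Nat.cast_nonneg k : (0 : ℝ) ≤ k)]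

end Radius

/-! ### The vote given the positions. -/

section Labels

variable {X : Type*} [MetricSpace X] {η : X → ℝ}

theorem measureReal_exists_blocks_le {s n k : ℕ} (T : Fin s → Finset (Fin n))
    (hT : ∀ j, (T j).card = k) {B : Set ℝ} (hB : MeasurableSet B) {t : ℝ} (ht : 0 ≤ t)
    (ht' : t < 1 / 2) (hp : 1 / 2 + t ≤ uniformUnit.real B) :
    (Measure.pi fun _ : Fin s × Fin n => uniformUnit).real
      {us | ∃ S : Finset (Fin s), s ≤ 4 * S.card ∧ us ∈ {us : Fin s × Fin n → ℝ |
        ∑ a ∈ Finset.univ.filter (fun a : Fin s × Fin n => a.1 ∈ S ∧ a.2 ∈ T a.1),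
          B.indicator (fun _ => (1 : ℝ)) (us a) ≤ (S.card * k : ℕ) / 2}} ≤
      2 ^ s * Real.exp (-(t ^ 2 * (s * k) / 2)) := by
  refine measureReal_exists_finset_le _ _ (Real.exp_pos _).le fun S hS => ?_
  have := measureReal_pi_count_le_half uniformUnit hB
    (Finset.univ.filter (fun a : Fin s × Fin n => a.1 ∈ S ∧ a.2 ∈ T a.1)) ht ht' hp
  rw [card_filter_blocks T hT] at this
  refine this.trans (Real.exp_le_exp.2 ?_)
  have h4 : (s : ℝ) ≤ 4 * S.card := by exact_mod_cast hS
  have : t ^ 2 * (s * k) ≤ t ^ 2 * (4 * S.card * k) := by gcongr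
  push_cast
  linarith

/-- Given the positions of the sample points, the vote at `x` is wrong with small probability. -/
theorem measureReal_bigNN_ne_le [MeasurableSpace X] {s n k : ℕ} (hs : 0 < s) (hk : 0 < k)
    (hkn : k ≤ n) (xs : Fin s × Fin n → X) (x : X) {r γ t : ℝ}
    (hR : 4 * (sparseBlocks xs k r x).card < s)
    (hη : ∀ y, dist x y ≤ r → |η y - η x| ≤ γ) (hγ : 0 ≤ γ) (ht : 0 ≤ t) (ht' : t < 1 / 2)
    (hx : γ + t < |η x - 1 / 2|) :
    (Measure.pi fun _ : Fin s × Fin n => uniformUnit).real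
      {us | bigNN (fun a => thresholdLabel η (xs a, us a)) k x ≠ bayesClassifier η x} ≤
      2 ^ s * Real.exp (-(t ^ 2 * (s * k) / 2)) := by
  set D : (Fin s × Fin n → ℝ) → Fin s × Fin n → X × Bool :=
    fun us a => thresholdLabel η (xs a, us a) with hD
  -- Neighbor sets depend on positions only, so the dummy label `true` is harmless and `T` does not
  -- vary with the uniforms.
  let T : Fin s → Finset (Fin n) := fun j => kNearest (fun i => (xs (j, i), true)) k x
  have hTD : ∀ us j, kNearest (fun i => D us (j, i)) k x = T j := fun us j => rfl
  have hT : ∀ j, (T j).card = k := fun j => card_kNearest _ x hkn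
  have hclose : ∀ j, j ∉ sparseBlocks xs k r x → ∀ i ∈ T j, |η (xs (j, i)) - η x| ≤ γ := by
    intro j hj i hi
    simp only [sparseBlocks, Finset.mem_filter, Finset.mem_univ, true_and, not_lt] at hj
    exact hη _ (dist_le_of_mem_kNearest (fun i => (xs (j, i), true)) x hj hi)
  rcases le_total (η x) (1 / 2) with hx2 | hx2
  · rw [abs_of_nonpos (by linarith)] at hx
    have hbayes : bayesClassifier η x = false := by simpa [bayesClassifier] using hx2
    -- Close neighbors satisfy `η < 1 / 2 - t`, so a uniform above `1 / 2 - t` forces label 0. This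
    -- one event serves all neighbors, although their label probabilities differ.
    refine (measureReal_mono ?_ (measure_ne_top _ _)).trans
      (measureReal_exists_blocks_le T hT (measurableSet_Ioi (a := 1 / 2 - t)) ht ht' ?_)
    · intro us hus
      rw [mem_ofPred_eq, hbayes, ne_eq, Bool.not_eq_false] at hus
      refine exists_blocks T _ us _ (sparseBlocks xs k r x) (bigNN_eq_true hs _ x hus) hR ?_
      intro j hj hjR
      simp only [Finset.mem_filter, Finset.mem_univ, true_and] at hj
      have hwrong := knnClassifier_eq_true hk hkn _ x hj
      rw [hTD] at hwrong
      refine le_trans (Finset.sum_le_sum fun i hi => ?_) hwrong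
      have hc := abs_le.1 (hclose j hjR i hi)
      by_cases hu : 1 / 2 - t < us (j, i)
      · have : ¬ us (j, i) ≤ η (xs (j, i)) := by
          rw [not_le]
          linarith [hc.2]
        simp [thresholdLabel, this, indicator]
        split_ifs <;> norm_num
      · rw [indicator_of_notMem (by simpa using hu)]
        split_ifs <;> norm_num
    · rw [uniformUnit_real_Ioi] <;> linarith
  · rw [abs_of_nonneg (by linarith)] at hx
    have hbayes : bayesClassifier η x = true := by
      simp only [bayesClassifier, decide_eq_true_eq]
      linarith
    -- Mirror case: close neighbors satisfy `η > 1 / 2 + t`, so a uniform at most `1 / 2 + t` forces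
    -- label 1.
    refine (measureReal_mono ?_ (measure_ne_top _ _)).trans
      (measureReal_exists_blocks_le T hT (measurableSet_Iic (a := 1 / 2 + t)) ht ht' ?_)
    · intro us hus
      rw [mem_ofPred_eq, hbayes, ne_eq, Bool.not_eq_true] at hus
      refine exists_blocks T _ us _ (sparseBlocks xs k r x) (bigNN_eq_false hs _ x hus) hR ?_
      intro j hj hjR
      simp only [Finset.mem_filter, Finset.mem_univ, true_and] at hj
      have hwrong := knnClassifier_eq_false hk _ x hj
      rw [hTD] at hwrong
      refine le_trans (Finset.sum_le_sum fun i hi => ?_) hwrong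
      have hc := abs_le.1 (hclose j hjR i hi)
      by_cases hu : us (j, i) ≤ 1 / 2 + t
      · have : us (j, i) ≤ η (xs (j, i)) := by linarith [hc.1]
        simp [thresholdLabel, this, indicator]
        split_ifs <;> norm_num
      · rw [indicator_of_notMem (by simpa using hu)]
        split_ifs <;> norm_num
    · rw [uniformUnit_real_Iic] <;> linarith

end Labels

/-! ### The vote at a training location. -/

section Vote

variable {X : Type*} [MetricSpace X] [TopologicalSpace.SeparableSpace X] [MeasurableSpace X]
  [BorelSpace X] {P : Measure (X × Bool)} [IsProbabilityMeasure P] {η : X → ℝ}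

/-- The bigNN classifier is unlikely to be wrong at the location of the training observation `a`,
if `η` is far from `1 / 2` there. -/
theorem measureReal_bigNN_ne_at_sample_le (h : IsRegressionFunction P η) {s n k : ℕ} (hk : 0 < k)
    (hkn : k ≤ n) (a : Fin s × Fin n) {r p γ t : ℝ} (hr : 0 ≤ r) (hp0 : 0 ≤ p)
    (hball : ∀ x, min 1 p ≤ P.fst.real (Metric.closedBall x r)) (hkp : 4 * k ≤ p * n)
    (hη : ∀ x y, dist x y ≤ r → |η y - η x| ≤ γ) (ht : 0 ≤ t) (hγ : 0 ≤ γ) :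
    (Measure.pi fun _ : Fin s × Fin n => P).real
      {D | γ + t < |η (D a).1 - 1 / 2| ∧ bigNN D k (D a).1 ≠ bayesClassifier η (D a).1} ≤
      2 * (2 ^ s * Real.exp (-(t ^ 2 * (s * k) / 2))) := by
  have hs : 0 < s := a.1.pos
  -- Since `|η - 1 / 2| ≤ 1 / 2`, the event is empty for `t ≥ 1 / 2`.
  rcases le_or_gt (1 / 2) t with ht' | ht'
  · have : {D : Fin s × Fin n → X × Bool | γ + t < |η (D a).1 - 1 / 2| ∧
        bigNN D k (D a).1 ≠ bayesClassifier η (D a).1} = ∅ := by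
      rw [eq_empty_iff_forall_notMem]
      rintro D ⟨hD, -⟩
      have : |η (D a).1 - 1 / 2| ≤ 1 / 2 := by
        have := h.nonneg (D a).1
        have := h.le_one (D a).1
        rw [abs_le]
        constructor <;> linarith
      linarith
    rw [this, measureReal_empty]
    positivity
  have hpos : Measurable fun D : Fin s × Fin n → X × Bool => (D a).1 :=
    measurable_fst.comp (measurable_pi_apply a)
  have hB : MeasurableSet {D : Fin s × Fin n → X × Bool | γ + t < |η (D a).1 - 1 / 2| ∧
        bigNN D k (D a).1 ≠ bayesClassifier η (D a).1} := by
    refine MeasurableSet.inter (s₁ := {D : Fin s × Fin n → X × Bool | γ + t < |η (D a).1 - 1 / 2|})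
      (measurableSet_lt measurable_const (((h.measurable.comp hpos).sub_const (1 / 2)).abs))
      (measurableSet_eq_fun (measurable_bigNN measurable_id hpos k)
        ((measurable_bayesClassifier h).comp hpos)).compl
  refine (measureReal_pi_le_add h hB {xs | s ≤ 4 * (sparseBlocks xs k r (xs a)).card}
    (c := 2 ^ s * Real.exp (-(t ^ 2 * (s * k) / 2))) (by positivity) fun xs hxs => ?_).trans ?_
  · rw [mem_ofPred_eq, not_le] at hxs
    by_cases hx : γ + t < |η (xs a) - 1 / 2|
    · refine (measureReal_mono ?_ (measure_ne_top _ _)).trans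
        (measureReal_bigNN_ne_le hs hk hkn xs (xs a) hxs (hη (xs a)) hγ ht ht' hx)
      exact fun us hus => hus.2
    · have : {us : Fin s × Fin n → ℝ | (fun b => thresholdLabel η (xs b, us b)) ∈
          {D : Fin s × Fin n → X × Bool | γ + t < |η (D a).1 - 1 / 2| ∧
            bigNN D k (D a).1 ≠ bayesClassifier η (D a).1}} = ∅ := by
        rw [eq_empty_iff_forall_notMem]
        exact fun us hus => hx hus.1
      rw [this, measureReal_empty]
      positivity
  · rw [two_mul]
    refine add_le_add_left ((measureReal_sparseBlocks_le hs hkn P.fst a hr hp0 hball hkp).trans ?_) _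
    -- Hence `t ^ 2 / 2 ≤ 1 / 4`, and the bound for sparse blocks is dominated by the one for
    -- labels.
    have : t ^ 2 ≤ 1 / 2 := by nlinarith
    have hsk : (0 : ℝ) ≤ s * k := by positivity
    refine mul_le_mul_of_nonneg_left (Real.exp_le_exp.2 (neg_le_neg ?_)) (by positivity)
    nlinarith

end Vote

/-! ### The subsample is a net of the space. -/

section Cover

variable {X : Type*} [MetricSpace X] [MeasurableSpace X] [BorelSpace X]

/-- With high probability, every point is close to the given subsample. -/
theorem measureReal_exists_far_le {P : Measure (X × Bool)} [IsProbabilityMeasure P] {d' : ℕ}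
    {Cd r : ℝ} (h : HasIntrinsicDim P.fst d' Cd) (hCd : 0 < Cd) (hr : 0 < r)
    {ι : Type*} [Fintype ι] {m : ℕ} (hm : 0 < m) (e : Fin m ↪ ι) (hV : 1 ≤ m * (Cd * r ^ d')) :
    (Measure.pi fun _ : ι => P).real {D | ∃ x, ∀ i, 4 * r < dist x (D (e i)).1} ≤
      m * Real.exp (-(m * (Cd * r ^ d'))) := by
  obtain ⟨F, hF, hnet⟩ := h.exists_net hCd hr
  set p := Cd * r ^ d' with hp
  have hp0 : 0 < p := by positivity
  have hm' : (0 : ℝ) < m := by exact_mod_cast hm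
  let E : X → Set (X × Bool) := fun z => Prod.fst ⁻¹' (Metric.closedBall z (2 * r))ᶜ
  have hE : ∀ z, (Measure.pi fun _ : ι => P).real {D | ∀ i, D (e i) ∈ E z} ≤
      (1 - min 1 p) ^ m := by
    intro z
    have hb : MeasurableSet (Metric.closedBall z (2 * r)) := measurableSet_closedBall
    have hPE : P.real (E z) = 1 - P.fst.real (Metric.closedBall z (2 * r)) := by
      rw [measureReal_def, ← Measure.fst_apply hb.compl, ← measureReal_def, measureReal_compl hb]
      simp
    rw [measureReal_pi_forall_mem, Fintype.card_fin]
    refine pow_le_pow_left₀ measureReal_nonneg ?_ m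
    rw [hPE]
    have hmono : P.fst.real (Metric.closedBall z r) ≤ P.fst.real (Metric.closedBall z (2 * r)) :=
      measureReal_mono (Metric.closedBall_subset_closedBall (by linarith))
    linarith [h z r hr]
  have hsub : {D : ι → X × Bool | ∃ x, ∀ i, 4 * r < dist x (D (e i)).1} ⊆
      ⋃ z ∈ F, {D | ∀ i, D (e i) ∈ E z} := by
    rintro D ⟨x, hx⟩
    obtain ⟨z, hz, hzx⟩ := hnet x
    simp only [mem_iUnion]
    refine ⟨z, hz, fun i => ?_⟩
    simp only [E, mem_preimage, mem_compl_iff, Metric.mem_closedBall, not_le]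
    have := dist_triangle x z (D (e i)).1
    rw [dist_comm x z, dist_comm z (D _).1] at this
    linarith [hx i]
  refine (measureReal_mono hsub (measure_ne_top _ _)).trans
    ((measureReal_biUnion_finset_le _ _).trans ?_)
  calc _ ≤ ∑ _z ∈ F, (1 - min 1 p) ^ m := Finset.sum_le_sum fun z _ => hE z
    _ = F.card * (1 - min 1 p) ^ m := by simp
    _ ≤ m * Real.exp (-(m * p)) := by
      rcases le_total 1 p with h1 | h1
      · rw [min_eq_left h1, sub_self, zero_pow hm.ne', mul_zero]
        positivity
      · rw [min_eq_right h1] at hF ⊢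
        have hcard : (F.card : ℝ) ≤ m := by
          refine le_of_mul_le_mul_right (hF.trans ?_) hp0
          exact hV
        have hexp : (1 - p) ^ m ≤ Real.exp (-(m * p)) := by
          rw [show -(m * p) = m * -p by ring, Real.exp_nat_mul]
          exact pow_le_pow_left₀ (by linarith) (by linarith [Real.add_one_le_exp (-p)]) m
        have : (0 : ℝ) ≤ (1 - p) ^ m := pow_nonneg (by linarith) m
        gcongr

end Cover

section Denoised

variable {X : Type*} [MetricSpace X] {η : X → ℝ}

/-- Two numbers whose distance is less than that of one of them from `1 / 2` lie on the same side
of `1 / 2`. -/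
theorem bayesClassifier_eq_of_abs_sub_lt {Y : Type*} {f : Y → ℝ} {x y : Y}
    (h : |f x - f y| < |f x - 1 / 2|) : bayesClassifier f x = bayesClassifier f y := by
  have h1 := abs_lt.1 h
  simp only [bayesClassifier, decide_eq_decide]
  rcases le_total (f x) (1 / 2) with hx | hx
  · rw [abs_of_nonpos (by linarith)] at h1
    constructor <;> intro h2 <;> linarith [h1.1, h1.2]
  · rw [abs_of_nonneg (by linarith)] at h1
    constructor <;> intro h2
    · linarith [h1.1, h1.2]
    · refine lt_of_le_of_ne hx fun heq => ?_
      rw [← heq] at h1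
      linarith [h1.1, h1.2]

theorem denoisedBigNN_eq_bayes {s n m : ℕ} [NeZero m] (D : Fin s × Fin n → X × Bool) (k : ℕ)
    (e : Fin m ↪ Fin s × Fin n) {r γ₁ γ₂ t : ℝ} (hγ₂ : 0 ≤ γ₂) (ht : 0 ≤ t)
    (hη : ∀ x y, dist x y ≤ r → |η y - η x| ≤ γ₁)
    (hclose : ∀ x, ∃ i, dist x (D (e i)).1 ≤ r)
    (hvote : ∀ i, γ₂ + t < |η (D (e i)).1 - 1 / 2| →
      bigNN D k (D (e i)).1 = bayesClassifier η (D (e i)).1)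
    (x : X) (hx : γ₁ + (γ₂ + t) < |η x - 1 / 2|) :
    denoisedBigNN D k e x = bayesClassifier η x := by
  obtain ⟨i, hi, hmin⟩ := exists_nearestNeighbor_eq (fun i => D (e i)) x
  obtain ⟨l, hl⟩ := hclose x
  have hd := hη x _ ((hmin l).trans hl)
  have htri : |η x - 1 / 2| ≤ |η (D (e i)).1 - η x| + |η (D (e i)).1 - 1 / 2| := by
    rw [abs_sub_comm (η (D (e i)).1) (η x)]
    exact abs_sub_le _ _ _
  rw [denoisedBigNN, hi, hvote i (by linarith)]
  refine (bayesClassifier_eq_of_abs_sub_lt ?_).symm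
  rw [abs_sub_comm]
  linarith

theorem abs_sub_le_of_holderWith {L α : ℝ≥0} (h : HolderWith L α η) {x y : X} {r : ℝ}
    (hxy : dist x y ≤ r) : |η y - η x| ≤ L * r ^ (α : ℝ) := by
  have := h.dist_le y x
  rw [Real.dist_eq] at this
  refine this.trans ?_
  rw [dist_comm]
  gcongr

end Denoised

section Estimates

/-- The exponential estimate behind the size conditions on the subsamples. -/
theorem two_pow_mul_exp_le {s k : ℕ} {t l : ℝ} (hk : 8 ≤ k * t ^ 2) (hl : 8 * l ≤ s * k * t ^ 2) :
    2 ^ s * Real.exp (-(t ^ 2 * (s * k) / 2)) ≤ Real.exp (-l) := by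
  have h2 : (2 : ℝ) ^ s ≤ Real.exp s := by
    rw [← mul_one (s : ℝ), Real.exp_nat_mul]
    exact pow_le_pow_left₀ (by norm_num) (by linarith [Real.add_one_le_exp (1 : ℝ)]) s
  calc _ ≤ Real.exp s * Real.exp (-(t ^ 2 * (s * k) / 2)) := by gcongr
    _ ≤ _ := by
      rw [← Real.exp_add]
      refine Real.exp_le_exp.2 ?_
      have : s * 8 ≤ s * (k * t ^ 2) := by gcongr
      nlinarith

end Estimates

theorem theorem3 (α L : ℝ≥0) (hα : 0 < α) (β C₀ : ℝ) (hβ : 0 ≤ β) (d' : ℕ) (hd' : 0 < d') :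
    ∃ C A : ℝ, 0 < C ∧ 0 < A ∧
      ∀ (X : Type*) [MetricSpace X] [TopologicalSpace.SeparableSpace X]
        [MeasurableSpace X] [BorelSpace X]
        (P : Measure (X × Bool)) [IsProbabilityMeasure P] (η : X → ℝ) (dvc : ℕ) (Cd : ℝ),
        IsRegressionFunction P η →
        vcDimension (closedBalls X) = (dvc : ℕ∞) →
        0 < Cd → HasIntrinsicDim P.fst d' Cd →
        HolderWith L α η →
        MarginCondition P η β C₀ →
        ∀ (s n k m : ℕ) [NeZero m] (e : Fin m ↪ Fin s × Fin n) (δ : ℝ),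
          0 < δ → δ < 1 → 0 < k → k ≤ n →
          -- the subsamples are large enough, for the given `m` and `δ`
          A * k * m ≤ n * (dvc * Real.log (m / δ)) →
          A ≤ k * ((dvc * Real.log (m / δ) / (m * Cd)) ^ ((α : ℝ) / d')) ^ 2 →
          A * Real.log (m / δ) ≤
            s * k * ((dvc * Real.log (m / δ) / (m * Cd)) ^ ((α : ℝ) / d')) ^ 2 →
          1 - 3 * δ ≤ (Measure.pi fun _ : Fin s × Fin n => P).real
            {D | regret P η (denoisedBigNN D k e) ≤ regret P η (bigNN D k) +
              C * (dvc * Real.log (m / δ) / (m * Cd)) ^ ((α : ℝ) * (β + 1) / d')} := by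
  set K : ℝ := L * 4 ^ (α : ℝ) + (L + 1) with hKdef
  have hK : 0 < K := by positivity
  refine ⟨2 * K * (|C₀| * K ^ β) + 1, 8, by positivity, by norm_num, ?_⟩
  intro X _ _ _ _ P _ η dvc Cd hreg _ hCd hdim hhol hmargin s n k m _ e δ hδ hδ1 hk hkn h1 h2 h3
  rcases le_or_gt (1 / 3) δ with hδ3 | hδ3
  · exact le_trans (by linarith) measureReal_nonneg
  have hm : 0 < m := Nat.pos_of_ne_zero (NeZero.ne m)
  have hm' : (1 : ℝ) ≤ m := by exact_mod_cast hm
  set l := Real.log (m / δ) with hl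
  have hl1 : 1 ≤ l := by
    rw [hl, Real.le_log_iff_exp_le (by positivity), le_div_iff₀ hδ]
    nlinarith [Real.exp_one_lt_d9, Real.exp_pos 1]
  have hexpl : Real.exp (-l) = δ / m := by
    rw [Real.exp_neg, hl, Real.exp_log (by positivity), inv_div]
  have hd0 : (d' : ℝ) ≠ 0 := by exact_mod_cast hd'.ne'
  have hα' : (0 : ℝ) < α := by exact_mod_cast hα
  have hdvc : 1 ≤ dvc := by
    by_contra hlt
    have h0 : dvc = 0 := by omega
    rw [h0, Nat.cast_zero, zero_mul, zero_div,
      Real.zero_rpow (div_pos hα' (by positivity)).ne'] at h2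
    norm_num at h2
  have hdvc' : (1 : ℝ) ≤ dvc := by exact_mod_cast hdvc
  set V : ℝ := dvc * l with hV
  have hVl : l ≤ V := by nlinarith
  have hV0 : 0 < V := by linarith
  set q : ℝ := V / (m * Cd) with hq
  have hq0 : 0 < q := by positivity
  set ρ : ℝ := q ^ (1 / (d' : ℝ)) with hρ
  have hρ0 : 0 < ρ := by positivity
  have hρd : ρ ^ d' = q := by
    rw [hρ, ← Real.rpow_natCast, ← Real.rpow_mul hq0.le, one_div_mul_cancel hd0, Real.rpow_one]
  set ψ : ℝ := q ^ ((α : ℝ) / d') with hψ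
  have hψ0 : 0 < ψ := by positivity
  have hρα : ρ ^ (α : ℝ) = ψ := by
    rw [hρ, hψ, ← Real.rpow_mul hq0.le, one_div_mul_eq_div]
  have hmass : Cd * ρ ^ d' = V / m := by
    rw [hρd, hq]
    field_simp
  have hmV : m * (Cd * ρ ^ d') = V := by
    rw [hmass]
    field_simp
  have hη1 : ∀ x y : X, dist x y ≤ 4 * ρ → |η y - η x| ≤ L * 4 ^ (α : ℝ) * ψ := fun x y hxy => by
    rw [mul_assoc, ← hρα, ← Real.mul_rpow (by norm_num) hρ0.le]
    exact abs_sub_le_of_holderWith hhol hxy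
  have hη2 : ∀ x y : X, dist x y ≤ ρ → |η y - η x| ≤ L * ψ := fun x y hxy => by
    rw [← hρα]
    exact abs_sub_le_of_holderWith hhol hxy
  let far : Set (Fin s × Fin n → X × Bool) := {D | ∃ x, ∀ i, 4 * ρ < dist x (D (e i)).1}
  let wrong : Fin m → Set (Fin s × Fin n → X × Bool) := fun i =>
    {D | L * ψ + ψ < |η (D (e i)).1 - 1 / 2| ∧
      bigNN D k (D (e i)).1 ≠ bayesClassifier η (D (e i)).1}
  have hfar : (Measure.pi fun _ : Fin s × Fin n => P).real far ≤ δ := by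
    refine (measureReal_exists_far_le hdim hCd hρ0 hm e (by rw [hmV]; linarith)).trans ?_
    rw [hmV]
    calc m * Real.exp (-V) ≤ m * Real.exp (-l) := by gcongr
      _ = δ := by rw [hexpl]; field_simp
  have hwrong : ∀ i, (Measure.pi fun _ : Fin s × Fin n => P).real (wrong i) ≤ 2 * (δ / m) := by
    intro i
    refine (measureReal_bigNN_ne_at_sample_le hreg hk hkn (e i) hρ0.le
      (p := Cd * ρ ^ d') (by positivity) (fun x => hdim x ρ hρ0) ?_ hη2 hψ0.le
      (by positivity)).trans ?_
    · rw [hmass, div_mul_eq_mul_div, le_div_iff₀ (by linarith)]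
      have : (0 : ℝ) ≤ k * m := by positivity
      nlinarith
    · rw [← hexpl]
      gcongr
      exact two_pow_mul_exp_le h2 h3
  have hgood : ∀ D, D ∉ far → (∀ i, D ∉ wrong i) →
      regret P η (denoisedBigNN D k e) ≤ regret P η (bigNN D k) +
        (2 * K * (|C₀| * K ^ β) + 1) * q ^ ((α : ℝ) * (β + 1) / d') := by
    intro D hDfar hDwrong
    have hagree := denoisedBigNN_eq_bayes (η := η) D k e (r := 4 * ρ) (γ₁ := L * 4 ^ (α : ℝ) * ψ)
      (γ₂ := L * ψ) (t := ψ) (by positivity) hψ0.le hη1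
      (fun x => by
        by_contra hx
        push Not at hx
        exact hDfar ⟨x, hx⟩)
      (fun i hi => by
        by_contra hne
        exact hDwrong i ⟨hi, hne⟩)
    have hKψ : L * 4 ^ (α : ℝ) * ψ + (L * ψ + ψ) = K * ψ := by
      rw [hKdef]
      ring
    rw [hKψ] at hagree
    have hle := regret_le hreg (measurable_denoisedBigNN D k e) (by positivity) hagree
    have hbig : 0 ≤ regret P η (bigNN D k) :=
      regret_nonneg hreg (measurable_bigNN measurable_const measurable_id k)
    have hpow : ψ * ψ ^ β = q ^ ((α : ℝ) * (β + 1) / d') := by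
      rw [hψ, ← Real.rpow_mul hq0.le, ← Real.rpow_add hq0]
      congr 1
      field_simp
      ring
    have hpow0 : 0 ≤ q ^ ((α : ℝ) * (β + 1) / d') := by positivity
    have hm1 : P.fst.real {x | |η x - 1 / 2| ≤ K * ψ} ≤ |C₀| * (K ^ β * ψ ^ β) := by
      refine (hmargin (K * ψ) (by positivity)).trans ?_
      rw [Real.mul_rpow hK.le hψ0.le]
      gcongr
      exact le_abs_self _
    calc _ ≤ 2 * (K * ψ) * (|C₀| * (K ^ β * ψ ^ β)) := hle.trans (by gcongr)
      _ = 2 * K * (|C₀| * K ^ β) * (ψ * ψ ^ β) := by ring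
      _ ≤ _ := by
        rw [hpow]
        linarith
  set G := {D | regret P η (denoisedBigNN D k e) ≤ regret P η (bigNN D k) +
        (2 * K * (|C₀| * K ^ β) + 1) * q ^ ((α : ℝ) * (β + 1) / d')} with hG
  have hcover : univ ⊆ G ∪ (far ∪ ⋃ i, wrong i) := by
    intro D _
    by_cases hD1 : D ∈ far
    · exact Or.inr (Or.inl hD1)
    by_cases hD2 : ∃ i, D ∈ wrong i
    · exact Or.inr (Or.inr (mem_iUnion.2 hD2))
    · exact Or.inl (hgood D hD1 (not_exists.1 hD2))
  have hsum : (Measure.pi fun _ : Fin s × Fin n => P).real (⋃ i, wrong i) ≤ 2 * δ :=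
    calc _ ≤ ∑ _i : Fin m, 2 * (δ / m) :=
          (measureReal_iUnion_fintype_le _).trans (Finset.sum_le_sum fun i _ => hwrong i)
      _ = 2 * δ := by
        simp
        field_simp
  have htotal : 1 ≤ (Measure.pi fun _ : Fin s × Fin n => P).real (G ∪ (far ∪ ⋃ i, wrong i)) := by
    rw [univ_subset_iff.1 hcover]
    simp
  have hu1 := measureReal_union_le (μ := Measure.pi fun _ : Fin s × Fin n => P) G
    (far ∪ ⋃ i, wrong i)
  have hu2 := measureReal_union_le (μ := Measure.pi fun _ : Fin s × Fin n => P) far (⋃ i, wrong i)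
  linarith
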